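/- Let $X, X_1, X_2, \ldots$ be i.i.d. random variables with values in $\{0,1,2,\ldots\}$. For $k \ge 0$ and $x \ge 0$ let $S_k(x) = \sum_{j=0}^k x^j/j!$ and $f_k(x) = e^{-x} S_k(x)$. For $n \ge 1$ put $\overline X_n = (X_1+\cdots+X_n)/n$, $F_n(k) = \frac1n\sum_{i=1}^n I(X_i \le k)$, $\widehat T_n^{(k)} = f_k(\overline X_n) - F_n(k)$, and let $\widetilde\sigma_{n,k} \ge 0$ be given by $$\widetilde\sigma_{n,k}^2 = e^{-2\overline X_n}\Big\{ S_k(\overline X_n)\big(e^{\overline X_n} - S_k(\overline X_n)\big) - \frac{\overline X_n^{2k+1}}{(k!)^2}\Big\}.$$ Let $$k^*_n = \min\Big\{k \ge 0 : I(\overline X_n \ge 1)\,\frac{\widetilde\sigma_{n,k}}{f_k^2(\overline X_n)\sqrt n} \le e\Big\}, \qquad W_n = \frac{\sqrt n\,\widehat T_n^{(k^*_n)}}{\widetilde\sigma_{n,k^*_n}},$$ with the convention $W_n = 0$ when $\overline X_n = 0$ (where $\widetilde\sigma_{n,k^*_n} = 0$). Let $\Delta$ be the class of distributions on $\{0,1,2,\ldots\}$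 with finite mean $\mu > 0$ and probability generating function $\Psi_X(t) = \mathrm E[t^X]$ such that $D(t,\mu) = \Psi_X'(t) - \mu\Psi_X(t)$ is either nonnegative for all $t\in[0,1]$ or nonpositive for all $t\in[0,1]$ (derivatives at $0$ and $1$ are one-sided). (i) If $X$ has a Poisson distribution with some parameter $\mu > 0$, then $W_n$ converges in distribution to $\mathcal N(0,1)$ as $n\to\infty$. (ii) If the distribution of $X$ belongs to $\Delta$ and is not a Poisson distribution with positive parameter, then $|W_n|$ converges to $\infty$ in probability, that is, $P(|W_n| > M) \to 1$ as $n\to\infty$ for every real $M$. -/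

import Mathlib

open MeasureTheory ProbabilityTheory Filter Topology
open scoped NNReal ENNReal

noncomputable section

namespace PoissonTest

/-- The mean `E[X]` of a count distribution `ν` on `ℕ`. -/
def mean (ν : Measure ℕ) : ℝ := ∫ x, (x : ℝ) ∂ν

/-- The probability generating function `Ψ_X(t) = E[t ^ X]` of a count distribution `ν`. -/
def pgf (ν : Measure ℕ) (t : ℝ) : ℝ := ∫ x, t ^ x ∂ν

/-- `D(t, μ) = Ψ_X'(t) - μ Ψ_X(t)`, where `Ψ_X` is considered on `[0, 1]` (so that the derivative
is one-sided at the endpoints). -/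
def pgfDiscrepancy (ν : Measure ℕ) (μ t : ℝ) : ℝ :=
  derivWithin (pgf ν) (Set.Icc 0 1) t - μ * pgf ν t

/-- The class `Δ` of count distributions with a finite mean `μ > 0` for which `D(·, μ)` has a
constant (weak) sign on `[0, 1]`. -/
structure ClassDelta (ν : Measure ℕ) : Prop where
  integrable : Integrable (fun x : ℕ => (x : ℝ)) ν
  mean_pos : 0 < mean ν
  sign : (∀ t ∈ Set.Icc (0 : ℝ) 1, 0 ≤ pgfDiscrepancy ν (mean ν) t) ∨
    (∀ t ∈ Set.Icc (0 : ℝ) 1, pgfDiscrepancy ν (mean ν) t ≤ 0)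

/-- `ν` is a Poisson distribution with a parameter `μ > 0`. -/
def IsPoisson (ν : Measure ℕ) : Prop := ∃ μ : ℝ≥0, 0 < μ ∧ ν = poissonMeasure μ

/-- `1 + x + ⋯ + x ^ k / k!`. -/
def expSum (k : ℕ) (x : ℝ) : ℝ := ∑ j ∈ Finset.range (k + 1), x ^ j / (j.factorial : ℝ)

/-- `f_k(x) = e ^ (-x) (1 + x + ⋯ + x ^ k / k!)`. -/
def f (k : ℕ) (x : ℝ) : ℝ := Real.exp (-x) * expSum k x

/-- The plug-in variance as a function of the value `x` of the sample mean:
`e ^ (-2x) {(1 + ⋯ + x ^ k / k!) (e ^ x - 1 - ⋯ - x ^ k / k!) - x ^ (2k+1) / (k!)²}`. -/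
def plugInVar (k : ℕ) (x : ℝ) : ℝ :=
  Real.exp (-2 * x) *
    (expSum k x * (Real.exp x - expSum k x) - x ^ (2 * k + 1) / (k.factorial : ℝ) ^ 2)

section Sample

variable {Ω : Type*}

/-- The sample mean of the first `n` observations `X 0, …, X (n - 1)`. -/
def sampleMean (X : ℕ → Ω → ℕ) (n : ℕ) (ω : Ω) : ℝ :=
  (∑ i ∈ Finset.range n, (X i ω : ℝ)) / n

/-- The empirical cumulative distribution function `F_n(k)` of the first `n` observations. -/
def empiricalCDF (X : ℕ → Ω → ℕ) (n k : ℕ) (ω : Ω) : ℝ :=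
  (∑ i ∈ Finset.range n, if X i ω ≤ k then (1 : ℝ) else 0) / n

/-- `T̂_n^(k) = f_k(X̄_n) - F_n(k)`. -/
def That (X : ℕ → Ω → ℕ) (n k : ℕ) (ω : Ω) : ℝ :=
  f k (sampleMean X n ω) - empiricalCDF X n k ω

/-- The plug-in standard deviation `σ̃_{n,k}`. -/
def sigmaTilde (X : ℕ → Ω → ℕ) (n k : ℕ) (ω : Ω) : ℝ :=
  Real.sqrt (plugInVar k (sampleMean X n ω))

/-- The condition `I(X̄_n ≥ 1) σ̃_{n,k} / (f_k(X̄_n)² √n) ≤ e` on the index `k`. -/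
def IsAdmissible (X : ℕ → Ω → ℕ) (n : ℕ) (ω : Ω) (k : ℕ) : Prop :=
  Set.indicator (Set.Ici (1 : ℝ)) (fun _ => (1 : ℝ)) (sampleMean X n ω) *
    (sigmaTilde X n k ω / (f k (sampleMean X n ω) ^ 2 * Real.sqrt n)) ≤ Real.exp 1

/-- The data-driven index `k*_n`: the smallest admissible natural number
(it exists by `isLeast_kStar` below). -/
def kStar (X : ℕ → Ω → ℕ) (n : ℕ) (ω : Ω) : ℕ := sInf {k | IsAdmissible X n ω k}

/-- The test statistic `W_n = √n T̂_n^(k*_n) / σ̃_{n,k*_n}`. -/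
def W (X : ℕ → Ω → ℕ) (n : ℕ) (ω : Ω) : ℝ :=
  Real.sqrt n * That X n (kStar X n ω) ω / sigmaTilde X n (kStar X n ω) ω

lemma tendsto_expSum (x : ℝ) : Tendsto (fun k => expSum k x) atTop (𝓝 (Real.exp x)) := by
  have h : HasSum (fun j : ℕ => x ^ j / (j.factorial : ℝ)) (Real.exp x) := by
    rw [Real.exp_eq_exp_ℝ]
    exact NormedSpace.expSeries_div_hasSum_exp x
  exact h.tendsto_sum_nat.comp (tendsto_add_atTop_nat 1)

lemma tendsto_plugInVar (x : ℝ) : Tendsto (fun k => plugInVar k x) atTop (𝓝 0) := by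
  have h1 := tendsto_expSum x
  have h2 := FloorSemiring.tendsto_pow_div_factorial_atTop x
  have h3 : Tendsto (fun k : ℕ => x ^ (2 * k + 1) / (k.factorial : ℝ) ^ 2) atTop (𝓝 0) := by
    have := (h2.mul h2).const_mul x
    simp only [mul_zero] at this
    refine this.congr fun k => ?_
    ring
  have := ((h1.mul (h1.const_sub (Real.exp x))).sub h3).const_mul (Real.exp (-2 * x))
  simpa [plugInVar] using this

lemma exists_isAdmissible (X : ℕ → Ω → ℕ) (n : ℕ) (ω : Ω) : ∃ k, IsAdmissible X n ω k := by
  rcases Nat.eq_zero_or_pos n with rfl | hn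
  · exact ⟨0, by simp [IsAdmissible, Real.exp_nonneg]⟩
  set x := sampleMean X n ω with hx
  have hs : Tendsto (fun k => sigmaTilde X n k ω) atTop (𝓝 0) := by
    simpa [sigmaTilde, hx] using (tendsto_plugInVar x).sqrt
  have hf : Tendsto (fun k => f k x) atTop (𝓝 1) := by
    have := (tendsto_expSum x).const_mul (Real.exp (-x))
    rwa [← Real.exp_add, neg_add_cancel, Real.exp_zero] at this
  have hn' : (1 : ℝ) ^ 2 * Real.sqrt n ≠ 0 := by positivity
  have key := (hs.div ((hf.pow 2).mul_const (Real.sqrt n)) hn').const_mul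
    (Set.indicator (Set.Ici (1 : ℝ)) (fun _ => (1 : ℝ)) x)
  rw [zero_div, mul_zero] at key
  obtain ⟨k, hk⟩ := (key.eventually (ge_mem_nhds (Real.exp_pos 1))).exists
  exact ⟨k, hk⟩

/-- The minimum defining `k*_n` is attained. -/
lemma isLeast_kStar (X : ℕ → Ω → ℕ) (n : ℕ) (ω : Ω) :
    IsLeast {k | IsAdmissible X n ω k} (kStar X n ω) :=
  ⟨Nat.sInf_mem (exists_isAdmissible X n ω), fun _ hk => Nat.sInf_le hk⟩

end Sample

end PoissonTest

end

/-!
The whole argument rests on the fact that the data-driven index is asymptotically trivial. By the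
strong law of large numbers `X̄_n → μ` almost surely, so `σ̃_{n,0} / f_0(X̄_n)²` stays bounded, the
factor `1 / √n` makes `k = 0` admissible for all large `n`, and almost surely
`W_n = √n (e ^ (-X̄_n) - F_n(0)) / σ(X̄_n)` eventually, where `σ²(x) = e ^ (-2x) (e ^ x - 1 - x)`
(`eventually_W_eq_Wzero`).

Under a Poisson law with parameter `r`, expand `e ^ (-x)` to first order at `r`. The linear part is
a normalised sum of the i.i.d. scores `g(X_i) = e ^ (-r) (1 + r - X_i) - 1{X_i = 0}`, which have mean
`0` and variance `σ²(r)` (`integral_linearScore`, `integral_linearScore_sq`), so the central limit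
theorem applies (`tendstoInDistribution_linear`). The Taylor remainder is at most
`√n (X̄_n - r)²`, which tends to `0` in probability by Chebyshev's inequality, and Slutsky's theorem
replaces `σ(r)` by `σ(X̄_n)` (`tendstoInDistribution_Wzero`).

Under a law of the class `Δ`, the function `t ↦ e ^ (-μ t) Ψ(t)` has derivative `e ^ (-μ t) D(t, μ)`,
hence is monotone on `[0, 1]`, with values `P(X = 0)` at `0` and `e ^ (-μ)` at `1`. If these agreed,
it would be constant and the law would be Poisson, since a generating function determines its law
(`isPoisson_of_real_singleton_zero`). Otherwise `e ^ (-X̄_n) - F_n(0)` tends almost surely to the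
nonzero number `e ^ (-μ) - P(X = 0)`, and the factor `√n` forces `|W_n| → ∞`
(`ae_tendsto_abs_W_atTop`).
-/

namespace PoissonTest

/-! ### Probability generating functions -/

section PGF

variable {ν ν' : Measure ℕ}

lemma integrable_pow_of_abs_le_one [IsFiniteMeasure ν] {t : ℝ} (ht : |t| ≤ 1) :
    Integrable (fun x : ℕ => t ^ x) ν :=
  Integrable.of_bound .of_discrete 1 (ae_of_all _ fun x => by
    simpa [abs_pow] using pow_le_one₀ (abs_nonneg t) ht)

lemma hasSum_pgf [IsFiniteMeasure ν] {t : ℝ} (ht : |t| ≤ 1) :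
    HasSum (fun k => ν.real {k} * t ^ k) (pgf ν t) := by
  have hν : Measure.sum (fun k => ν {k} • Measure.dirac k) = ν := Measure.sum_smul_dirac ν
  have hint := integrable_pow_of_abs_le_one (ν := ν) ht
  rw [← hν] at hint
  have h := hasSum_integral_sum_dirac (fun k => measure_ne_top ν {k})
    ((integrable_sum_dirac_iff fun k => measure_ne_top ν {k}).1 hint)
  rw [hν] at h
  exact h

lemma hasFPowerSeriesOnBall_pgf [IsProbabilityMeasure ν] :
    HasFPowerSeriesOnBall (pgf ν) (.ofScalars ℝ fun k => ν.real {k}) 0 1 where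
  r_le := by
    refine FormalMultilinearSeries.le_radius_of_bound _ (r := 1) 1 fun n => ?_
    simp only [FormalMultilinearSeries.ofScalars_norm, NNReal.coe_one, one_pow, mul_one,
      Real.norm_eq_abs, abs_of_nonneg measureReal_nonneg]
    exact measureReal_le_one
  r_pos := one_pos
  hasSum {y} hy := by
    have hy' : |y| ≤ 1 := by
      have : ‖y‖ₑ < 1 := by simpa [edist_zero_right] using hy
      rw [← Real.norm_eq_abs]
      rw [← ofReal_norm, ENNReal.ofReal_lt_one] at this
      exact this.le
    simpa [FormalMultilinearSeries.ofScalars_apply_eq, mul_comm] using hasSum_pgf (ν := ν) hy'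

lemma differentiableAt_pgf [IsProbabilityMeasure ν] {t : ℝ} (ht : |t| < 1) :
    DifferentiableAt ℝ (pgf ν) t :=
  (hasFPowerSeriesOnBall_pgf.analyticAt_of_mem (by
    simpa [edist_zero_right, ← ofReal_norm] using ht)).differentiableAt

lemma continuousOn_pgf [IsFiniteMeasure ν] : ContinuousOn (pgf ν) (Set.Icc 0 1) := by
  refine continuousOn_of_dominated (bound := fun _ => 1) (fun _ _ => .of_discrete) (fun t ht => ?_)
    (integrable_const _) (ae_of_all _ fun x => by fun_prop)
  refine ae_of_all _ fun x => ?_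
  rw [norm_pow, Real.norm_eq_abs, abs_of_nonneg ht.1]
  exact pow_le_one₀ ht.1 ht.2

lemma pgf_zero [IsFiniteMeasure ν] : pgf ν 0 = ν.real {0} := by
  have h := hasSum_pgf (ν := ν) (t := 0) (by simp)
  refine h.unique ?_
  convert hasSum_single (f := fun k => ν.real {k} * (0 : ℝ) ^ k) 0 ?_ using 1
  · simp
  · intro k hk
    simp [hk]

lemma pgf_one [IsProbabilityMeasure ν] : pgf ν 1 = 1 := by simp [pgf]

/-- The probability generating function on `[0, 1]` determines a distribution on `ℕ`: two power
series that agree on `(0, 1]` have the same coefficients. -/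
lemma eq_of_pgf_eqOn [IsProbabilityMeasure ν] [IsProbabilityMeasure ν']
    (h : Set.EqOn (pgf ν) (pgf ν') (Set.Icc 0 1)) : ν = ν' := by
  have h1 := (hasFPowerSeriesOnBall_pgf (ν := ν)).hasFPowerSeriesAt
  have h2 := (hasFPowerSeriesOnBall_pgf (ν := ν')).hasFPowerSeriesAt
  have hfr : ∃ᶠ t in 𝓝[≠] (0 : ℝ), pgf ν t = pgf ν' t := by
    have hev : ∀ᶠ t in 𝓝[>] (0 : ℝ), pgf ν t = pgf ν' t := by
      filter_upwards [Ioc_mem_nhdsGT (zero_lt_one' ℝ)] with t ht using h ⟨ht.1.le, ht.2⟩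
    exact hev.frequently.filter_mono (nhdsWithin_mono _ fun t ht => ne_of_gt ht)
  have hev := (h1.analyticAt.frequently_eq_iff_eventually_eq h2.analyticAt).1 hfr
  have hc := h1.eq_formalMultilinearSeries_of_eventually h2 hev
  rw [FormalMultilinearSeries.ofScalars_series_eq_iff] at hc
  refine Measure.ext_of_singleton fun k => ?_
  have := congrFun hc k
  rwa [measureReal_eq_measureReal_iff] at this

lemma pgf_poissonMeasure (r : ℝ≥0) {t : ℝ} (ht : t ∈ Set.Icc (0 : ℝ) 1) :
    pgf (poissonMeasure r) t = Real.exp (-r) * Real.exp (r * t) := by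
  have h := hasSum_pgf (ν := poissonMeasure r) (t := t) (abs_le.2 ⟨by linarith [ht.1], ht.2⟩)
  refine h.unique ?_
  have h2 := (NormedSpace.expSeries_div_hasSum_exp ((r : ℝ) * t)).mul_left (Real.exp (-r))
  rw [← Real.exp_eq_exp_ℝ] at h2
  convert! h2 using 2 with k
  rw [poissonMeasure_real_singleton, mul_pow]
  ring

lemma hasDerivAt_exp_mul_pgf [IsProbabilityMeasure ν] (μ : ℝ) {t : ℝ}
    (ht : t ∈ Set.Ioo (0 : ℝ) 1) :
    HasDerivAt (fun t => Real.exp (-μ * t) * pgf ν t)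
      (Real.exp (-μ * t) * pgfDiscrepancy ν μ t) t := by
  have h1 : HasDerivAt (pgf ν) (derivWithin (pgf ν) (Set.Icc 0 1) t) t := by
    rw [derivWithin_of_mem_nhds (Icc_mem_nhds ht.1 ht.2)]
    exact (differentiableAt_pgf (abs_lt.2 ⟨by linarith [ht.1], ht.2⟩)).hasDerivAt
  have h2 : HasDerivAt (fun t : ℝ => Real.exp (-μ * t)) (Real.exp (-μ * t) * (-μ * 1)) t :=
    ((hasDerivAt_id t).const_mul (-μ)).exp
  convert! h2.mul h1 using 1
  rw [pgfDiscrepancy]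
  ring

lemma continuousOn_exp_mul_pgf [IsFiniteMeasure ν] (μ : ℝ) :
    ContinuousOn (fun t => Real.exp (-μ * t) * pgf ν t) (Set.Icc 0 1) :=
  ContinuousOn.mul (by fun_prop) continuousOn_pgf

/-- When `D(·, μ)` has a constant sign, `t ↦ e ^ (-μ t) Ψ(t)` is monotone on `[0, 1]`, because its
derivative is `e ^ (-μ t) D(t, μ)`. If in addition it takes the same value at both endpoints, it is
constant, and `Ψ` is the generating function of a Poisson distribution. -/
lemma isPoisson_of_real_singleton_zero [IsProbabilityMeasure ν] (hν : ClassDelta ν)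
    (h0 : ν.real {0} = Real.exp (-mean ν)) : IsPoisson ν := by
  set μ := mean ν with hμ
  set h : ℝ → ℝ := fun t => Real.exp (-μ * t) * pgf ν t with hh
  have e0 : h 0 = Real.exp (-μ) := by simp [hh, pgf_zero, h0]
  have e1 : h 1 = Real.exp (-μ) := by simp [hh, pgf_one]
  have hc := continuousOn_exp_mul_pgf (ν := ν) μ
  have hd : ∀ t ∈ interior (Set.Icc (0 : ℝ) 1),
      HasDerivWithinAt h (Real.exp (-μ * t) * pgfDiscrepancy ν μ t) (interior (Set.Icc 0 1)) t := by
    intro t ht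
    rw [interior_Icc] at ht
    exact (hasDerivAt_exp_mul_pgf μ ht).hasDerivWithinAt
  have hconst : ∀ t ∈ Set.Icc (0 : ℝ) 1, h t = Real.exp (-μ) := by
    intro t ht
    have m0 : (0 : ℝ) ∈ Set.Icc (0 : ℝ) 1 := by simp
    have m1 : (1 : ℝ) ∈ Set.Icc (0 : ℝ) 1 := by simp
    rcases hν.sign with hs | hs
    · have hm : MonotoneOn h (Set.Icc 0 1) :=
        monotoneOn_of_hasDerivWithinAt_nonneg (convex_Icc 0 1) hc hd fun t ht =>
          mul_nonneg (Real.exp_nonneg _) (hs t (interior_subset ht))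
      exact le_antisymm (e1 ▸ hm ht m1 ht.2) (e0 ▸ hm m0 ht ht.1)
    · have hm : AntitoneOn h (Set.Icc 0 1) :=
        antitoneOn_of_hasDerivWithinAt_nonpos (convex_Icc 0 1) hc hd fun t ht =>
          mul_nonpos_of_nonneg_of_nonpos (Real.exp_nonneg _) (hs t (interior_subset ht))
      exact le_antisymm (e0 ▸ hm m0 ht ht.1) (e1 ▸ hm ht m1 ht.2)
  obtain ⟨r, hr⟩ : ∃ r : ℝ≥0, (r : ℝ) = μ := ⟨⟨μ, hν.mean_pos.le⟩, rfl⟩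
  refine ⟨r, NNReal.coe_pos.1 (by rw [hr]; exact hν.mean_pos), eq_of_pgf_eqOn fun t ht => ?_⟩
  rw [pgf_poissonMeasure _ ht, hr, ← hconst t ht, hh, mul_right_comm, ← Real.exp_add]
  simp

end PGF

/-! ### Moments of the Poisson distribution -/

section PoissonMoments

variable (r : ℝ≥0)

lemma hasSum_poisson_descFactorial_one :
    HasSum (fun n : ℕ => Real.exp (-r) * r ^ n / n.factorial * (n : ℝ)) r := by
  rw [← hasSum_nat_add_iff' 1]
  convert! (hasSum_one_poissonMeasure r).mul_left (r : ℝ) using 1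
  · ext n
    rw [Nat.factorial_succ]
    push_cast
    field_simp
    ring
  · simp

lemma hasSum_poisson_descFactorial_two :
    HasSum (fun n : ℕ => Real.exp (-r) * r ^ n / n.factorial * ((n : ℝ) * (n - 1))) (r ^ 2) := by
  rw [← hasSum_nat_add_iff' 2]
  convert! (hasSum_one_poissonMeasure r).mul_left ((r : ℝ) ^ 2) using 1
  · ext n
    rw [Nat.factorial_succ, Nat.factorial_succ]
    push_cast
    field_simp
    ring
  · simp [Finset.sum_range_succ]

lemma integral_poissonMeasure_eq {g : ℕ → ℝ} {a : ℝ}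
    (h : HasSum (fun n : ℕ => Real.exp (-r) * r ^ n / n.factorial * g n) a) :
    Integrable g (poissonMeasure r) ∧ ∫ n, g n ∂poissonMeasure r = a := by
  refine ⟨integrable_poissonMeasure_iff.2 ?_, ?_⟩
  · convert! h.summable.abs using 2 with n
    rw [abs_mul, abs_of_nonneg (by positivity), Real.norm_eq_abs]
  · rw [integral_poissonMeasure]
    exact h.tsum_eq

lemma mean_poissonMeasure : mean (poissonMeasure r) = r :=
  (integral_poissonMeasure_eq r (hasSum_poisson_descFactorial_one r)).2

lemma integrable_cast_poissonMeasure : Integrable (fun n : ℕ => (n : ℝ)) (poissonMeasure r) :=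
  (integral_poissonMeasure_eq r (hasSum_poisson_descFactorial_one r)).1

lemma integrable_cast_sq_poissonMeasure :
    Integrable (fun n : ℕ => (n : ℝ) ^ 2) (poissonMeasure r) := by
  refine (integral_poissonMeasure_eq r (a := r ^ 2 + r) ?_).1
  convert! (hasSum_poisson_descFactorial_two r).add (hasSum_poisson_descFactorial_one r) using 2
  ring

/-- The summand of the linear statistic that approximates `f_0(X̄_n) - F_n(0)`, obtained by
expanding `e ^ (-x)` to first order at `r`. -/
noncomputable def linearScore (r : ℝ) (x : ℕ) : ℝ :=
  Real.exp (-r) * (1 + r - x) - if x ≤ 0 then 1 else 0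

lemma hasSum_poisson_single_zero (c : ℝ) :
    HasSum (fun n : ℕ => Real.exp (-r) * r ^ n / n.factorial * if n ≤ 0 then c else 0)
      (Real.exp (-r) * c) := by
  convert! hasSum_single
    (f := fun n : ℕ => Real.exp (-r) * r ^ n / n.factorial * if n ≤ 0 then c else 0) 0 ?_ using 1
  · simp
  · intro n hn
    simp [hn]

lemma integral_linearScore : ∫ n, linearScore r n ∂poissonMeasure r = 0 := by
  refine (integral_poissonMeasure_eq r ?_).2
  have h := ((((hasSum_one_poissonMeasure r).mul_left (1 + (r : ℝ))).sub
    (hasSum_poisson_descFactorial_one r)).mul_left (Real.exp (-r))).sub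
    (hasSum_poisson_single_zero r 1)
  convert! h using 1
  · ext n
    simp only [linearScore]
    ring
  · ring

lemma integral_linearScore_sq :
    ∫ n, linearScore r n ^ 2 ∂poissonMeasure r = plugInVar 0 r := by
  refine (integral_poissonMeasure_eq r ?_).2
  have h := (((((hasSum_one_poissonMeasure r).mul_left ((1 + (r : ℝ)) ^ 2)).sub
    ((hasSum_poisson_descFactorial_one r).mul_left (1 + 2 * (r : ℝ)))).add
    (hasSum_poisson_descFactorial_two r)).mul_left (Real.exp (-r) ^ 2)).add
    (hasSum_poisson_single_zero r (1 - 2 * Real.exp (-r) * (1 + r)))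
  convert! h using 1
  · ext n
    rcases Nat.eq_zero_or_pos n with rfl | hn
    · simp [linearScore]
      ring
    · simp [linearScore, hn.ne']
      ring
  · have e1 : Real.exp (-2 * r) = Real.exp (-r) ^ 2 := by
      rw [← Real.exp_nat_mul]
      ring_nf
    have e2 : Real.exp (-r) * Real.exp r = 1 := by rw [← Real.exp_add]; simp
    simp only [plugInVar, expSum, e1]
    simp
    linear_combination Real.exp (-r) * e2

end PoissonMoments

lemma plugInVar_zero_pos {x : ℝ} (hx : 0 < x) : 0 < plugInVar 0 x := by
  have := Real.add_one_lt_exp hx.ne'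
  have h : plugInVar 0 x = Real.exp (-2 * x) * (Real.exp x - 1 - x) := by simp [plugInVar, expSum]
  rw [h]
  exact mul_pos (Real.exp_pos _) (by linarith)

lemma continuous_plugInVar_zero : Continuous (plugInVar 0) := by
  unfold plugInVar expSum
  fun_prop

/-- First-order Taylor remainder of `e ^ (-x)`, by convexity of the exponential at both points. -/
lemma abs_exp_neg_sub_linear_le {x r : ℝ} (hx : 0 ≤ x) (hr : 0 ≤ r) :
    |Real.exp (-x) - Real.exp (-r) + Real.exp (-r) * (x - r)| ≤ (x - r) ^ 2 := by
  have a1 : Real.exp (-r) * (1 + (r - x)) ≤ Real.exp (-x) := by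
    have : Real.exp (-x) = Real.exp (-r) * Real.exp (r - x) := by rw [← Real.exp_add]; ring_nf
    rw [this]
    exact mul_le_mul_of_nonneg_left (by linarith [Real.add_one_le_exp (r - x)]) (Real.exp_nonneg _)
  have a2 : Real.exp (-x) * (1 + (x - r)) ≤ Real.exp (-r) := by
    have : Real.exp (-r) = Real.exp (-x) * Real.exp (x - r) := by rw [← Real.exp_add]; ring_nf
    rw [this]
    exact mul_le_mul_of_nonneg_left (by linarith [Real.add_one_le_exp (x - r)]) (Real.exp_nonneg _)
  have b1 : Real.exp (-x) ≤ 1 := Real.exp_le_one_iff.2 (by linarith)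
  have b2 : Real.exp (-r) ≤ 1 := Real.exp_le_one_iff.2 (by linarith)
  rw [abs_le]
  constructor
  · nlinarith [sq_nonneg (x - r)]
  · rcases le_total x r with h | h
    · nlinarith [mul_nonneg (sub_nonneg.2 h) (sub_nonneg.2 h)]
    · nlinarith [mul_nonneg (sub_nonneg.2 h) (sub_nonneg.2 h)]

/-! ### The statistic for large samples -/

section Statistic

variable {Ω : Type*}

lemma W_congr {Ω' : Type*} {X : ℕ → Ω → ℕ} {Y : ℕ → Ω' → ℕ} {n : ℕ} {ω : Ω} {ω' : Ω'}
    (h : ∀ i < n, X i ω = Y i ω') : W X n ω = W Y n ω' := by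
  have hm : sampleMean X n ω = sampleMean Y n ω' := by
    simp only [sampleMean]
    congr 1
    exact Finset.sum_congr rfl fun i hi => by rw [h i (Finset.mem_range.1 hi)]
  have hF (k : ℕ) : empiricalCDF X n k ω = empiricalCDF Y n k ω' := by
    simp only [empiricalCDF]
    congr 1
    exact Finset.sum_congr rfl fun i hi => by rw [h i (Finset.mem_range.1 hi)]
  simp only [W, That, kStar, IsAdmissible, sigmaTilde, hm, hF]

lemma aemeasurable_W [MeasurableSpace Ω] {P : Measure Ω} {X : ℕ → Ω → ℕ}
    (hX : ∀ i, AEMeasurable (X i) P) (n : ℕ) : AEMeasurable (W X n) P := by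
  -- `W_n` factors through the countable space of samples of size `n`.
  let Y (v : Fin n → ℕ) (i : ℕ) (_ : Unit) : ℕ := if h : i < n then v ⟨i, h⟩ else 0
  have hfac : W X n = (fun v => W (Y v) n ()) ∘ fun ω i => X i ω := by
    ext ω
    exact W_congr (Y := Y fun i => X i ω) (ω' := ()) fun i hi => by simp [Y, hi]
  rw [hfac]
  exact Measurable.of_discrete.comp_aemeasurable (aemeasurable_pi_lambda _ fun i => hX i)

lemma f_zero (x : ℝ) : f 0 x = Real.exp (-x) := by simp [f, expSum]

/-- The statistic `W_n` with the data-driven index replaced by `0`. -/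
noncomputable def Wzero (X : ℕ → Ω → ℕ) (n : ℕ) (ω : Ω) : ℝ :=
  Real.sqrt n * That X n 0 ω / sigmaTilde X n 0 ω

/-- As long as the sample means stay bounded, the factor `1 / √n` makes the index `0` admissible. -/
lemma eventually_W_eq_Wzero {X : ℕ → Ω → ℕ} {ω : Ω} {μ : ℝ}
    (h : Tendsto (fun n => sampleMean X n ω) atTop (𝓝 μ)) :
    ∀ᶠ n in atTop, W X n ω = Wzero X n ω := by
  have hs : Tendsto (fun n => sigmaTilde X n 0 ω) atTop (𝓝 √(plugInVar 0 μ)) :=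
    ((continuous_plugInVar_zero.tendsto μ).comp h).sqrt
  have hf : Tendsto (fun n => f 0 (sampleMean X n ω) ^ 2) atTop (𝓝 (Real.exp (-μ) ^ 2)) := by
    simp only [f_zero]
    exact ((Real.continuous_exp.tendsto _).comp h.neg).pow 2
  have hn : Tendsto (fun n : ℕ => √(n : ℝ)) atTop atTop :=
    Real.tendsto_sqrt_atTop.comp tendsto_natCast_atTop_atTop
  have key : Tendsto (fun n : ℕ => sigmaTilde X n 0 ω / (f 0 (sampleMean X n ω) ^ 2 * √(n : ℝ)))
      atTop (𝓝 0) :=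
    hs.div_atTop (hf.pos_mul_atTop (by positivity) hn)
  filter_upwards [key.eventually (ge_mem_nhds (Real.exp_pos 1))] with n hn
  have hadm : IsAdmissible X n ω 0 := by
    refine le_trans (mul_le_of_le_one_left (by unfold sigmaTilde; positivity) ?_) hn
    exact Set.indicator_le_self' (fun _ _ => zero_le_one) _
  have hk : kStar X n ω = 0 := Nat.le_zero.1 ((isLeast_kStar X n ω).2 hadm)
  rw [W, Wzero, hk]

/-- `√n` times the first-order Taylor remainder of `e ^ (-x)` at the sample mean. -/
noncomputable def taylorRemainder (X : ℕ → Ω → ℕ) (r : ℝ) (n : ℕ) (ω : Ω) : ℝ :=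
  √(n : ℝ) * (Real.exp (-sampleMean X n ω) - Real.exp (-r) + Real.exp (-r) * (sampleMean X n ω - r))

/-- Decomposition of `W_n` at index `0` into the standardised linear statistic, the Taylor remainder
and the ratio of the true and the plug-in standard deviations. It holds for all `n` and `ω`: when
`σ̃_{n,0} = 0`, division by zero makes both sides `0`. -/
lemma Wzero_eq {X : ℕ → Ω → ℕ} {r s : ℝ} (hs : s ≠ 0) (n : ℕ) (ω : Ω) :
    Wzero X n ω = ((√(n : ℝ))⁻¹ * ∑ i ∈ Finset.range n, linearScore r (X i ω) / s
      + taylorRemainder X r n ω / s) * (s / sigmaTilde X n 0 ω) := by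
  rcases Nat.eq_zero_or_pos n with rfl | hn
  · simp [Wzero, taylorRemainder]
  have hn' : (0 : ℝ) < n := by exact_mod_cast hn
  have hsq : (√(n : ℝ))⁻¹ = √(n : ℝ) / n := by
    rw [eq_div_iff hn'.ne', inv_mul_eq_iff_eq_mul₀ (Real.sqrt_pos.2 hn').ne',
      Real.mul_self_sqrt hn'.le]
  have hsum : ∑ i ∈ Finset.range n, linearScore r (X i ω) / s =
      n * (Real.exp (-r) * (1 + r - sampleMean X n ω) - empiricalCDF X n 0 ω) / s := by
    rw [← Finset.sum_div]
    congr 1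
    simp only [linearScore, Finset.sum_sub_distrib, ← Finset.mul_sum, sampleMean, empiricalCDF,
      Finset.sum_const, Finset.card_range, nsmul_eq_mul]
    field_simp
  rw [hsum, hsq, Wzero, That, f_zero, taylorRemainder]
  field_simp
  ring

end Statistic

/-! ### Almost sure limits -/

section IID

variable {Ω : Type*} [MeasurableSpace Ω] {P : Measure Ω} {ν : Measure ℕ} {X : ℕ → Ω → ℕ}

lemma identDistrib_comp (hlaw : ∀ i, HasLaw (X i) ν P) (g : ℕ → ℝ) (i : ℕ) :
    IdentDistrib (fun ω => g (X i ω)) (fun ω => g (X 0 ω)) P P :=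
  IdentDistrib.comp ⟨(hlaw i).aemeasurable, (hlaw 0).aemeasurable,
    (hlaw i).map_eq.trans (hlaw 0).map_eq.symm⟩ (Measurable.of_discrete (f := g))

lemma integrable_comp (hlaw : ∀ i, HasLaw (X i) ν P) {g : ℕ → ℝ} (hg : Integrable g ν) (i : ℕ) :
    Integrable (fun ω => g (X i ω)) P := by
  rw [← (hlaw i).map_eq] at hg
  exact hg.comp_aemeasurable (hlaw i).aemeasurable

lemma integral_comp (hlaw : ∀ i, HasLaw (X i) ν P) (g : ℕ → ℝ) (i : ℕ) :
    ∫ ω, g (X i ω) ∂P = ∫ x, g x ∂ν :=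
  (hlaw i).integral_comp .of_discrete

lemma aemeasurable_sampleMean (hX : ∀ i, AEMeasurable (X i) P) (n : ℕ) :
    AEMeasurable (sampleMean X n) P := by
  unfold sampleMean
  refine (Finset.aemeasurable_fun_sum _ fun i _ => ?_).div_const _
  exact (Measurable.of_discrete (f := fun x : ℕ => (x : ℝ))).comp_aemeasurable (hX i)

lemma ae_tendsto_average (hindep : iIndepFun X P) (hlaw : ∀ i, HasLaw (X i) ν P) {g : ℕ → ℝ}
    (hg : Integrable g ν) :
    ∀ᵐ ω ∂P, Tendsto (fun n : ℕ => (∑ i ∈ Finset.range n, g (X i ω)) / n) atTop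
      (𝓝 (∫ x, g x ∂ν)) := by
  rw [← integral_comp hlaw g 0]
  refine strong_law_ae_real (fun i ω => g (X i ω)) (integrable_comp hlaw hg 0) (fun i j hij => ?_)
    (identDistrib_comp hlaw g)
  exact (hindep.indepFun hij).comp .of_discrete .of_discrete

lemma ae_tendsto_sampleMean (hindep : iIndepFun X P) (hlaw : ∀ i, HasLaw (X i) ν P)
    (hg : Integrable (fun x : ℕ => (x : ℝ)) ν) :
    ∀ᵐ ω ∂P, Tendsto (fun n => sampleMean X n ω) atTop (𝓝 (mean ν)) :=
  ae_tendsto_average hindep hlaw hg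

lemma ae_tendsto_empiricalCDF_zero [IsFiniteMeasure ν] (hindep : iIndepFun X P)
    (hlaw : ∀ i, HasLaw (X i) ν P) :
    ∀ᵐ ω ∂P, Tendsto (fun n => empiricalCDF X n 0 ω) atTop (𝓝 (ν.real {0})) := by
  have hind : (fun x : ℕ => if x ≤ 0 then (1 : ℝ) else 0) = Set.indicator {0} 1 := by
    ext x
    simp [Set.indicator_apply]
  have hint : ∫ x, (if x ≤ 0 then (1 : ℝ) else 0) ∂ν = ν.real {0} := by
    rw [hind, integral_indicator_one (by simp)]
  rw [← hint]
  refine ae_tendsto_average hindep hlaw (g := fun x : ℕ => if x ≤ 0 then (1 : ℝ) else 0) ?_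
  rw [hind]
  exact (integrable_const (1 : ℝ)).indicator (by simp)

/-- Divergence under an alternative: `f_0(X̄_n) - F_n(0)` has a nonzero limit. -/
lemma ae_tendsto_abs_W_atTop [IsProbabilityMeasure ν] (hindep : iIndepFun X P)
    (hlaw : ∀ i, HasLaw (X i) ν P) (hν : ClassDelta ν) (hP : ¬ IsPoisson ν) :
    ∀ᵐ ω ∂P, Tendsto (fun n => |W X n ω|) atTop atTop := by
  filter_upwards [ae_tendsto_sampleMean hindep hlaw hν.integrable,
    ae_tendsto_empiricalCDF_zero hindep hlaw] with ω h1 h2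
  set d := Real.exp (-mean ν) - ν.real {0} with hd
  have hd0 : 0 < |d| := abs_pos.2 fun h =>
    hP (isPoisson_of_real_singleton_zero hν (sub_eq_zero.1 h).symm)
  have hs0 : 0 < √(plugInVar 0 (mean ν)) := Real.sqrt_pos.2 (plugInVar_zero_pos hν.mean_pos)
  have hs : Tendsto (fun n => sigmaTilde X n 0 ω) atTop (𝓝 √(plugInVar 0 (mean ν))) :=
    ((continuous_plugInVar_zero.tendsto _).comp h1).sqrt
  have hT : Tendsto (fun n => That X n 0 ω) atTop (𝓝 d) := by
    simp only [That, f_zero]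
    exact ((Real.continuous_exp.tendsto _).comp h1.neg).sub h2
  have hn : Tendsto (fun n : ℕ => √(n : ℝ)) atTop atTop :=
    Real.tendsto_sqrt_atTop.comp tendsto_natCast_atTop_atTop
  have hlim := hn.atTop_mul_pos (div_pos hd0 hs0) (hT.abs.div hs hs0.ne')
  refine hlim.congr' ?_
  filter_upwards [eventually_W_eq_Wzero h1] with n hW
  rw [hW, Wzero, abs_div, abs_mul, abs_of_nonneg (Real.sqrt_nonneg _),
    abs_of_nonneg (a := sigmaTilde X n 0 ω) (Real.sqrt_nonneg _), mul_div_assoc]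
  rfl

lemma tendsto_measure_one_of_ae_tendsto_atTop [IsProbabilityMeasure P] {Y : ℕ → Ω → ℝ}
    (hY : ∀ n, AEMeasurable (Y n) P) (h : ∀ᵐ ω ∂P, Tendsto (fun n => Y n ω) atTop atTop) (M : ℝ) :
    Tendsto (fun n => P {ω | M < Y n ω}) atTop (𝓝 1) := by
  have heq (n : ℕ) : P {ω | M < Y n ω} = P {ω | M < (hY n).mk _ ω} := by
    refine measure_congr ?_
    filter_upwards [(hY n).ae_eq_mk] with ω hω
    exact congrArg (M < ·) hω
  simp_rw [heq]
  rw [← measure_univ (μ := P)]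
  refine tendsto_measure_of_ae_tendsto_indicator_of_isFiniteMeasure atTop .univ
    (fun n => measurableSet_lt measurable_const (hY n).measurable_mk) ?_
  filter_upwards [h, ae_all_iff.2 fun n => (hY n).ae_eq_mk] with ω hω heq
  filter_upwards [hω.eventually_gt_atTop M] with n hn
  simpa [← heq n] using hn

end IID

/-! ### Asymptotic normality under the Poisson hypothesis -/

section Normality

variable {Ω : Type*} [MeasurableSpace Ω] {P : Measure Ω} [IsProbabilityMeasure P]
  {X : ℕ → Ω → ℕ}

/-- By Chebyshev's inequality, `P(√n (X̄_n - μ)² ≥ ε) ≤ Var X / (ε √n)`. -/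
lemma tendstoInMeasure_sqrt_mul_sampleMean_sub_sq {ν : Measure ℕ} (hindep : iIndepFun X P)
    (hlaw : ∀ i, HasLaw (X i) ν P) (hν : MemLp (fun x : ℕ => (x : ℝ)) 2 ν) :
    TendstoInMeasure P (fun (n : ℕ) ω => √(n : ℝ) * (sampleMean X n ω - mean ν) ^ 2) atTop
      (fun _ => 0) := by
  have : IsProbabilityMeasure ν := (hlaw 0).isProbabilityMeasure_iff.1 inferInstance
  set Y : ℕ → Ω → ℝ := fun i ω => (X i ω : ℝ) with hY
  have hYL (i : ℕ) : MemLp (Y i) 2 P := by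
    rw [← (hlaw i).map_eq] at hν
    exact hν.comp_of_map (hlaw i).aemeasurable
  set v := Var[Y 0; P] with hv
  have hvar (i : ℕ) : Var[Y i; P] = v := (identDistrib_comp hlaw (fun x => (x : ℝ)) i).variance_eq
  have hmean (i : ℕ) : P[Y i] = mean ν := integral_comp hlaw (fun x => (x : ℝ)) i
  have hS (n : ℕ) : MemLp (∑ i ∈ Finset.range n, Y i) 2 P := memLp_finsetSum' _ fun i _ => hYL i
  have hSvar (n : ℕ) : Var[∑ i ∈ Finset.range n, Y i; P] = n * v := by
    rw [IndepFun.variance_sum (fun i _ => hYL i) fun i _ j _ hij =>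
      (hindep.indepFun hij).comp .of_discrete .of_discrete]
    simp [hvar]
  have hSmean (n : ℕ) : P[∑ i ∈ Finset.range n, Y i] = n * mean ν := by
    simp only [Finset.sum_apply]
    rw [integral_finsetSum _ fun i _ => (hYL i).integrable one_le_two]
    simp [hmean]
  rw [tendstoInMeasure_iff_norm]
  intro ε hε
  have hn : Tendsto (fun n : ℕ => √(n : ℝ)) atTop atTop :=
    Real.tendsto_sqrt_atTop.comp tendsto_natCast_atTop_atTop
  have hlim : Tendsto (fun n : ℕ => ENNReal.ofReal (v / ε / √(n : ℝ))) atTop (𝓝 0) := by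
    simpa using ENNReal.tendsto_ofReal (hn.const_div_atTop (v / ε))
  refine tendsto_of_tendsto_of_tendsto_of_le_of_le' tendsto_const_nhds hlim
    (.of_forall fun _ => zero_le) ?_
  filter_upwards [eventually_gt_atTop 0] with n hn0
  have hn0' : (0 : ℝ) < n := by exact_mod_cast hn0
  have hsq : √(n : ℝ) * √(n : ℝ) = n := Real.mul_self_sqrt hn0'.le
  have hsp : 0 < √(n : ℝ) := Real.sqrt_pos.2 hn0'
  -- In terms of the sum `S_n` the event reads `ε n √n ≤ (S_n - n μ)²`.
  have hc : 0 < ε * (n * √(n : ℝ)) := by positivity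
  have hcheb := meas_ge_le_variance_div_sq (hS n) (Real.sqrt_pos.2 hc)
  rw [hSvar, hSmean, Real.sq_sqrt hc.le] at hcheb
  refine (measure_mono fun ω hω => ?_).trans (hcheb.trans_eq ?_)
  · have hω' : ε ≤ √(n : ℝ) * (sampleMean X n ω - mean ν) ^ 2 := by
      simpa [abs_of_nonneg hsp.le] using hω
    refine Real.le_sqrt' (Real.sqrt_pos.2 hc) |>.2 ?_ |>.trans_eq (Real.sqrt_sq_eq_abs _)
    rw [Real.sq_sqrt hc.le]
    have hSn : (∑ i ∈ Finset.range n, Y i) ω - n * mean ν = n * (sampleMean X n ω - mean ν) := by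
      simp only [sampleMean, Finset.sum_apply, hY]
      field_simp
    rw [hSn]
    calc ε * (n * √(n : ℝ)) ≤ √(n : ℝ) * (sampleMean X n ω - mean ν) ^ 2 * (n * √(n : ℝ)) := by
          gcongr
      _ = (√(n : ℝ) * √(n : ℝ)) * n * (sampleMean X n ω - mean ν) ^ 2 := by ring
      _ = (n * (sampleMean X n ω - mean ν)) ^ 2 := by rw [hsq]; ring
  · congr 1
    field_simp

/-- The central limit theorem for the linearised statistic; `Var g(X) = σ²(r)` for the score `g`. -/
lemma tendstoInDistribution_linear {r : ℝ≥0} (hr : 0 < r) (hindep : iIndepFun X P)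
    (hlaw : ∀ i, HasLaw (X i) (poissonMeasure r) P) :
    TendstoInDistribution
      (fun (n : ℕ) ω => (√(n : ℝ))⁻¹ *
        ∑ i ∈ Finset.range n, linearScore r (X i ω) / √(plugInVar 0 r))
      atTop (id : ℝ → ℝ) (fun _ => P) (gaussianReal 0 1) := by
  set s := √(plugInVar 0 r) with hs
  have hpos : 0 < plugInVar 0 r := plugInVar_zero_pos (NNReal.coe_pos.2 hr)
  refine tendstoInDistribution_inv_sqrt_mul_sum
    (X := fun i ω => linearScore r (X i ω) / s) HasLaw.id ?_ ?_ ?_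
    (identDistrib_comp hlaw fun x => linearScore r x / s)
  · rw [integral_comp hlaw (fun x => linearScore r x / s) 0, integral_div, integral_linearScore,
      zero_div]
  · have h := integral_comp hlaw (fun x => (linearScore r x / s) ^ 2) 0
    simp only [div_pow] at h
    rw [integral_div, integral_div, integral_linearScore_sq, hs, Real.sq_sqrt hpos.le,
      div_self hpos.ne'] at h
    simp only [Pi.pow_apply, div_pow]
    rw [integral_div, hs, Real.sq_sqrt hpos.le, h]
  · exact hindep.comp (fun _ x => linearScore r x / s) fun _ => .of_discrete

lemma tendstoInMeasure_taylorRemainder_div {r : ℝ≥0} (hindep : iIndepFun X P)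
    (hlaw : ∀ i, HasLaw (X i) (poissonMeasure r) P) {s : ℝ} (hs : 0 < s) :
    TendstoInMeasure P (fun n ω => taylorRemainder X r n ω / s) atTop (fun _ => 0) := by
  have hL : MemLp (fun x : ℕ => (x : ℝ)) 2 (poissonMeasure r) :=
    (memLp_two_iff_integrable_sq .of_discrete).2 (integrable_cast_sq_poissonMeasure r)
  have h := tendstoInMeasure_sqrt_mul_sampleMean_sub_sq hindep hlaw hL
  rw [mean_poissonMeasure, tendstoInMeasure_iff_norm] at h
  rw [tendstoInMeasure_iff_norm]
  intro ε hε
  refine tendsto_of_tendsto_of_tendsto_of_le_of_le tendsto_const_nhds (h (ε * s) (by positivity))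
    (fun _ => zero_le) fun n => measure_mono fun ω hω => ?_
  have hx : 0 ≤ sampleMean X n ω := by unfold sampleMean; positivity
  have hb := abs_exp_neg_sub_linear_le hx r.coe_nonneg
  simp only [Set.mem_ofPred_eq, sub_zero, Real.norm_eq_abs, taylorRemainder, abs_div,
    abs_of_pos hs, abs_mul, abs_of_nonneg (Real.sqrt_nonneg (n : ℝ)), le_div_iff₀ hs] at hω ⊢
  refine hω.trans ?_
  rw [abs_of_nonneg (sq_nonneg (sampleMean X n ω - r))]
  gcongr

lemma tendstoInDistribution_Wzero {r : ℝ≥0} (hr : 0 < r) (hindep : iIndepFun X P)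
    (hlaw : ∀ i, HasLaw (X i) (poissonMeasure r) P) :
    TendstoInDistribution (Wzero X) atTop (id : ℝ → ℝ) (fun _ => P) (gaussianReal 0 1) := by
  have hX (i : ℕ) : AEMeasurable (X i) P := (hlaw i).aemeasurable
  have hsm (n : ℕ) : AEMeasurable (sampleMean X n) P := aemeasurable_sampleMean hX n
  set s := √(plugInVar 0 r) with hs
  have hs0 : 0 < s := Real.sqrt_pos.2 (plugInVar_zero_pos (NNReal.coe_pos.2 hr))
  have hσ (n : ℕ) : AEMeasurable (fun ω => s / sigmaTilde X n 0 ω) P :=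
    ((continuous_plugInVar_zero.measurable.comp_aemeasurable (hsm n)).sqrt).const_div s
  have hR (n : ℕ) : AEMeasurable (fun ω => taylorRemainder X r n ω / s) P := by
    unfold taylorRemainder
    have := hsm n
    fun_prop
  have hsum := (tendstoInDistribution_linear hr hindep hlaw).add_of_tendstoInMeasure_const
    (tendstoInMeasure_taylorRemainder_div hindep hlaw hs0) hR
  have hratio : TendstoInMeasure P (fun n ω => s / sigmaTilde X n 0 ω) atTop (fun _ => 1) := by
    refine tendstoInMeasure_of_tendsto_ae (fun n => (hσ n).aestronglyMeasurable) ?_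
    filter_upwards [ae_tendsto_sampleMean hindep hlaw (integrable_cast_poissonMeasure r)] with ω hω
    rw [mean_poissonMeasure] at hω
    have h : Tendsto (fun n => sigmaTilde X n 0 ω) atTop (𝓝 s) :=
      ((continuous_plugInVar_zero.tendsto _).comp hω).sqrt
    have h' := (tendsto_const_nhds (x := s)).div h hs0.ne'
    rwa [div_self hs0.ne'] at h'
  have hprod := hsum.continuous_comp_prodMk_of_tendstoInMeasure_const
    (g := fun p : ℝ × ℝ => p.1 * p.2) (by fun_prop) hratio hσ
  refine hprod.congr (fun n => ae_of_all _ fun ω => ?_) (ae_of_all _ fun ω => by simp)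
  exact (Wzero_eq hs0.ne' n ω).symm

lemma tendstoInDistribution_of_ae_eventually_eq {Ω' : Type*} [MeasurableSpace Ω']
    {P' : Measure Ω'} [IsProbabilityMeasure P'] {Y W : ℕ → Ω → ℝ} {Z : Ω' → ℝ}
    (hY : TendstoInDistribution Y atTop Z (fun _ => P) P') (hW : ∀ n, AEMeasurable (W n) P)
    (h : ∀ᵐ ω ∂P, ∀ᶠ n in atTop, W n ω = Y n ω) :
    TendstoInDistribution W atTop Z (fun _ => P) P' := by
  refine tendstoInDistribution_of_tendstoInMeasure_sub W Z hY ?_ hW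
  refine tendstoInMeasure_of_tendsto_ae
    (fun n => ((hW n).sub (hY.forall_aemeasurable n)).aestronglyMeasurable) ?_
  filter_upwards [h] with ω hω
  refine tendsto_const_nhds.congr' ?_
  filter_upwards [hω] with n hn
  simp [hn]

end Normality

end PoissonTest

theorem corollary2 {Ω : Type*} [MeasurableSpace Ω] (P : Measure Ω) [IsProbabilityMeasure P]
    (ν : Measure ℕ) (X : ℕ → Ω → ℕ)
    (hindep : iIndepFun X P) (hlaw : ∀ i, HasLaw (X i) ν P) :
    (PoissonTest.IsPoisson ν →
      TendstoInDistribution (PoissonTest.W X) atTop (id : ℝ → ℝ) (fun _ => P) (gaussianReal 0 1)) ∧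
    (PoissonTest.ClassDelta ν → ¬ PoissonTest.IsPoisson ν →
      ∀ M : ℝ, Tendsto (fun n => P {ω | M < |PoissonTest.W X n ω|}) atTop (𝓝 1)) := by
  have : IsProbabilityMeasure ν := (hlaw 0).isProbabilityMeasure_iff.1 inferInstance
  have hW := PoissonTest.aemeasurable_W fun i => (hlaw i).aemeasurable
  refine ⟨?_, fun hν hP M => ?_⟩
  · rintro ⟨r, hr, rfl⟩
    refine PoissonTest.tendstoInDistribution_of_ae_eventually_eq
      (PoissonTest.tendstoInDistribution_Wzero hr hindep hlaw) hW ?_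
    filter_upwards [PoissonTest.ae_tendsto_sampleMean hindep hlaw
      (PoissonTest.integrable_cast_poissonMeasure r)] with ω hω
    exact PoissonTest.eventually_W_eq_Wzero hω
  · exact PoissonTest.tendsto_measure_one_of_ae_tendsto_atTop
      (fun n => (hW n).abs) (PoissonTest.ae_tendsto_abs_W_atTop hindep hlaw hν hP) M
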